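/- **Conventions.** All graphs are finite and simple. For a graph $H$ with vertex set $W$ and edge set $E(H)$, the symmetric edge polytope $\mathcal P_H\subset\mathbb R^W$ is the convex hull of $\{\pm(\mathbf e_i-\mathbf e_j) : \{i,j\}\in E(H)\}$, where $\mathbf e_i$ is the $i$-th unit coordinate vector, and $N(\mathcal P)$ denotes the number of facets of a polytope $\mathcal P$ (faces of dimension $\dim\mathcal P-1$). The suspension $\widehat H$ of $H$ is obtained from $H$ by adding one new vertex joined to all vertices of $H$. For a vertex $v$ of a graph $G=(V,E)$, let $N_G(v)$ be the set of vertices adjacent to $v$ and $N_G[v]=N_G(v)\cup\{v\}$. Let $G-v$ be the subgraph of $G$ induced on $V\setminus\{v\}$; if $N_G[v]\ne V$, let $G-N_G[v]$ be the subgraph of $G$ induced on $V\setminus N_G[v]$; and let $G/v$ be the graph obtained from $G$ by removing $v$ and inserting all edges $\{i,j\}$ with $i,j\in N_G(v)$, $i\neq j$. **Proposition.** Let $n\ge 3$, let $G$ be a graph on a vertex set $V$ with $|V|=n-1$, and let $v$ be a vertex of $G$. If $N_G[v]\neq V$, then $$N(\mathcal P_{\widehat{G-v}})+N(\mathcal P_{\widehat{G/v}})\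 \le\ N(\mathcal P_{\widehat G})\ \le\ N(\mathcal P_{\widehat{G-v}})+2\,N(\mathcal P_{\widehat{G-N_G[v]}})+N(\mathcal P_{\widehat{G/v}}).$$ If $N_G[v]=V$, then $$N(\mathcal P_{\widehat G})=N(\mathcal P_{\widehat{G-v}})+N(\mathcal P_{\widehat{G/v}})+2.$$ -/

import Mathlib

/-- The set `F` is a facet of the convex polytope `P`: a nonempty (exposed) face of `P` whose
dimension is `dim P - 1`, where the dimension of a nonempty convex set is that of its affine
hull. (Faces are sets of maximizers on `P` of a linear functional.) -/
def IsFacet {E : Type*} [AddCommGroup E] [Module ℝ E] [TopologicalSpace E]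
    (P F : Set E) : Prop :=
  IsExposed ℝ P F ∧ F.Nonempty ∧
    Module.finrank ℝ (vectorSpan ℝ F) + 1 = Module.finrank ℝ (vectorSpan ℝ P)

/-- The number `N(P)` of facets of a polytope `P`. -/
noncomputable def numFacets {E : Type*} [AddCommGroup E] [Module ℝ E] [TopologicalSpace E]
    (P : Set E) : ℕ :=
  {F : Set E | IsFacet P F}.ncard

namespace SimpleGraph

/-- The symmetric edge polytope of `G`: the convex hull in `ℝ^V` of the vectors `± (e_i - e_j)`
for the edges `{i, j}` of `G`. (Adjacency is symmetric, so both signs occur.) -/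
def symEdgePolytope {V : Type*} [DecidableEq V] (G : SimpleGraph V) : Set (V → ℝ) :=
  convexHull ℝ {x | ∃ i j : V, G.Adj i j ∧ x = Pi.single i 1 - Pi.single j 1}

/-- The suspension of `G`: one new vertex `none`, joined to all vertices of `G`. -/
def suspension {V : Type*} (G : SimpleGraph V) : SimpleGraph (Option V) where
  Adj
    | none, none => False
    | none, some _ => True
    | some _, none => True
    | some a, some b => G.Adj a b
  symm := ⟨by
    rintro (_ | a) (_ | b) h
    · exact h
    · trivial
    · trivial
    · exact SimpleGraph.Adj.symm (G := G) h⟩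
  loopless := ⟨by
    rintro (_ | a) h
    · exact h
    · exact G.loopless.irrefl a h⟩

/-- The closed neighbourhood `N_G[v] = N_G(v) ∪ {v}`. -/
def closedNbhd {V : Type*} (G : SimpleGraph V) (v : V) : Set V :=
  G.neighborSet v ∪ {v}

/-- `G - v`, the subgraph induced on the vertices other than `v`. -/
def deleteVertex {V : Type*} (G : SimpleGraph V) (v : V) :
    SimpleGraph ({v}ᶜ : Set V) :=
  G.induce ({v}ᶜ : Set V)

/-- `G - N_G[v]`, the subgraph induced on the vertices outside `N_G[v]`. -/
def deleteClosedNbhd {V : Type*} (G : SimpleGraph V) (v : V) :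
    SimpleGraph ((G.closedNbhd v)ᶜ : Set V) :=
  G.induce ((G.closedNbhd v)ᶜ : Set V)

/-- `G / v`: remove `v` and insert all edges `{i, j}` with distinct `i, j ∈ N_G(v)`. -/
def contractVertex {V : Type*} (G : SimpleGraph V) (v : V) :
    SimpleGraph ({v}ᶜ : Set V) where
  Adj a b := G.Adj a b ∨ (a ≠ b ∧ G.Adj v a ∧ G.Adj v b)
  symm := ⟨by
    rintro a b (h | ⟨h, ha, hb⟩)
    · exact Or.inl h.symm
    · exact Or.inr ⟨h.symm, hb, ha⟩⟩
  loopless := ⟨by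
    rintro a (h | ⟨h, -, -⟩)
    · exact G.loopless.irrefl _ h
    · exact h rfl⟩

end SimpleGraph

open SimpleGraph Module

/-! ### Convexity and linear algebra -/

/-! Scale a facet-defining functional to have maximum 1 and let it vanish at the apex of the
suspension. It then becomes a sign vector on the vertices of `H`: no edge joins 1 to -1, and every 0
has a nonzero neighbour. This is a bijection with the facets
(`numFacets_symEdgePolytope_suspension`), so the theorem is a count of sign vectors.

Group the sign vectors of `G` by their restriction `g` to the complement of `v`. The number of
admissible values at `v` equals the number of times `g` counts for `G - v` and `G / v` together,
unless `g` is a defect: it vanishes on the neighbours of `v`, and some such neighbour sees no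
nonzero value outside `v`. A defect extends by both 1 and -1 but counts for neither smaller graph,
which gives the exact formula `ncard_facetSigns_eq`. Defects restrict injectively to sign vectors of
`G - N_G[v]`; if `v` is adjacent to everything, zero is the only defect. -/

theorem mem_span_of_mem_convexHull_of_eq_one {E : Type*} [AddCommGroup E] [Module ℝ E]
    {s : Set E} (φ : E →ₗ[ℝ] ℝ) (hφ : ∀ x ∈ s, φ x ≤ 1) {x : E} (hx : x ∈ convexHull ℝ s)
    (h1 : φ x = 1) : x ∈ Submodule.span ℝ {y ∈ s | φ y = 1} := by
  -- A convex combination with value 1 gives weight zero to every point of value below 1.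
  have hC : Convex ℝ {x | φ x ≤ 1 ∧ (φ x = 1 → x ∈ Submodule.span ℝ {y ∈ s | φ y = 1})} := by
    intro x hx y hy a b ha hb hab
    obtain ⟨hx, hx'⟩ := hx
    obtain ⟨hy, hy'⟩ := hy
    have hval : φ (a • x + b • y) = a * φ x + b * φ y := by simp
    refine ⟨by rw [hval]; nlinarith, fun h => ?_⟩
    rw [hval] at h
    have hax : a * (1 - φ x) = 0 := by nlinarith
    have hby : b * (1 - φ y) = 0 := by nlinarith
    refine Submodule.add_mem _ ?_ ?_
    · rcases mul_eq_zero.1 hax with h0 | h0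
      · simp [h0]
      · exact Submodule.smul_mem _ _ (hx' (by linarith))
    · rcases mul_eq_zero.1 hby with h0 | h0
      · simp [h0]
      · exact Submodule.smul_mem _ _ (hy' (by linarith))
  have hsub : s ⊆ {x | φ x ≤ 1 ∧ (φ x = 1 → x ∈ Submodule.span ℝ {y ∈ s | φ y = 1})} :=
    fun y hy => And.intro (hφ y hy) fun h => Submodule.subset_span ⟨hy, h⟩
  exact (convexHull_min hsub hC hx).2 h1

/-- The hyperplane `φ = 1` misses the origin, so passing from directions to the linear span adds one
dimension. A face on it is thus a facet exactly when it spans as much as the polytope, provided the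
latter contains 0. -/
theorem finrank_vectorSpan_add_one_of_eq_one {E : Type*} [AddCommGroup E] [Module ℝ E]
    [FiniteDimensional ℝ E] {F : Set E} (hF : F.Nonempty) (φ : E →ₗ[ℝ] ℝ)
    (hφ : ∀ x ∈ F, φ x = 1) :
    finrank ℝ (vectorSpan ℝ F) + 1 = finrank ℝ (Submodule.span ℝ F) := by
  obtain ⟨p, hp⟩ := hF
  have hker : vectorSpan ℝ F ≤ LinearMap.ker φ := by
    rw [vectorSpan_eq_span_vsub_set_right ℝ hp, Submodule.span_le]
    rintro _ ⟨x, hx, rfl⟩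
    simp [hφ x hx, hφ p hp]
  have hp0 : p ≠ 0 := by
    rintro rfl
    simpa using hφ 0 hp
  have hsup : vectorSpan ℝ F ⊔ Submodule.span ℝ {p} = Submodule.span ℝ F := by
    apply le_antisymm
    · refine sup_le ?_ (Submodule.span_mono (by simpa using hp))
      rw [vectorSpan_eq_span_vsub_set_right ℝ hp, Submodule.span_le]
      rintro _ ⟨x, hx, rfl⟩
      exact Submodule.sub_mem _ (Submodule.subset_span hx) (Submodule.subset_span hp)
    · rw [Submodule.span_le]
      intro x hx
      have := Submodule.add_mem_sup (vsub_mem_vectorSpan ℝ hx hp)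
        (Submodule.mem_span_singleton_self (R := ℝ) p)
      simpa using this
  have hinf : vectorSpan ℝ F ⊓ Submodule.span ℝ {p} = ⊥ := by
    rw [eq_bot_iff]
    rintro x ⟨hx, hx'⟩
    obtain ⟨c, rfl⟩ := Submodule.mem_span_singleton.1 hx'
    have h0 : φ (c • p) = 0 := hker hx
    simp [hφ p hp] at h0
    simp [h0]
  have := Submodule.finrank_sup_add_finrank_inf_eq (vectorSpan ℝ F) (Submodule.span ℝ {p})
  rw [hsup, hinf, finrank_span_singleton hp0] at this
  simpa using this.symm

theorem vectorSpan_convexHull_eq_span {E : Type*} [AddCommGroup E] [Module ℝ E] {s : Set E}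
    (h0 : (0 : E) ∈ convexHull ℝ s) : vectorSpan ℝ (convexHull ℝ s) = Submodule.span ℝ s := by
  apply le_antisymm
  · rw [vectorSpan_eq_span_vsub_set_right ℝ h0, Submodule.span_le]
    rintro _ ⟨x, hx, rfl⟩
    simpa using convexHull_min Submodule.subset_span (Submodule.span ℝ s).convex hx
  · rw [Submodule.span_le]
    intro x hx
    simpa using vsub_mem_vectorSpan ℝ (subset_convexHull ℝ s hx) h0

/-! ### Facets of the symmetric edge polytope of a suspension -/

namespace SimpleGraph

section Facets

variable {V : Type*} [DecidableEq V] (H : SimpleGraph V)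

/-- The vectors `e_i - e_j` over the edges `{i, j}`, in both orientations. -/
def edgeVectors {W : Type*} [DecidableEq W] (G : SimpleGraph W) : Set (W → ℝ) :=
  {x | ∃ i j : W, G.Adj i j ∧ x = Pi.single i 1 - Pi.single j 1}

/-- The sign vectors which are the values on `V` of the functionals defining the facets of the
symmetric edge polytope of the suspension of `H`. -/
def facetSigns {V : Type*} (H : SimpleGraph V) : Set (V → SignType) :=
  {f | (∀ a b, H.Adj a b → f a = 1 → f b ≠ -1) ∧ ∀ a, f a = 0 → ∃ b, H.Adj a b ∧ f b ≠ 0}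

/-- The vector `e_u - e_none`. -/
def spoke (u : V) : Option V → ℝ := Pi.single (some u) 1 - Pi.single none 1

theorem spoke_mem_edgeVectors (u : V) : spoke u ∈ H.suspension.edgeVectors :=
  ⟨some u, none, trivial, rfl⟩

theorem neg_mem_edgeVectors {W : Type*} [DecidableEq W] (G : SimpleGraph W) {x : W → ℝ}
    (hx : x ∈ G.edgeVectors) : -x ∈ G.edgeVectors := by
  obtain ⟨i, j, h, rfl⟩ := hx
  exact ⟨j, i, h.symm, by simp⟩

theorem span_edgeVectors_suspension :
    Submodule.span ℝ H.suspension.edgeVectors = Submodule.span ℝ (Set.range (spoke (V := V))) := by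
  apply le_antisymm
  · rw [Submodule.span_le]
    rintro _ ⟨i, j, -, rfl⟩
    have key : ∀ i : Option V, (Pi.single i 1 - Pi.single none 1 : Option V → ℝ) ∈
        Submodule.span ℝ (Set.range (spoke (V := V))) := by
      rintro (_ | u)
      · simp
      · exact Submodule.subset_span ⟨u, rfl⟩
    simpa using Submodule.sub_mem _ (key i) (key j)
  · apply Submodule.span_mono
    rintro _ ⟨u, rfl⟩
    exact H.spoke_mem_edgeVectors u

theorem eqOn_span_edgeVectors_suspension {φ ψ : (Option V → ℝ) →ₗ[ℝ] ℝ}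
    (h : ∀ u, φ (spoke u) = ψ (spoke u)) {x : Option V → ℝ}
    (hx : x ∈ Submodule.span ℝ H.suspension.edgeVectors) : φ x = ψ x := by
  rw [span_edgeVectors_suspension] at hx
  refine LinearMap.eqOn_span (s := Set.range (spoke (V := V))) ?_ hx
  rintro _ ⟨u, rfl⟩
  exact h u

theorem symEdgePolytope_subset_span {W : Type*} [DecidableEq W] (G : SimpleGraph W) :
    G.symEdgePolytope ⊆ Submodule.span ℝ G.edgeVectors :=
  convexHull_min Submodule.subset_span (Submodule.span ℝ G.edgeVectors).convex

theorem neg_mem_symEdgePolytope {W : Type*} [DecidableEq W] (G : SimpleGraph W) {x : W → ℝ}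
    (hx : x ∈ G.symEdgePolytope) : -x ∈ G.symEdgePolytope := by
  have hneg : -G.edgeVectors = G.edgeVectors := by
    ext y
    exact ⟨fun h => by simpa using G.neg_mem_edgeVectors h, fun h => G.neg_mem_edgeVectors h⟩
  have : -x ∈ -convexHull ℝ G.edgeVectors := by
    rw [Set.neg_mem_neg]
    exact hx
  rw [← convexHull_neg, hneg] at this
  exact this

theorem zero_mem_symEdgePolytope_suspension [Nonempty V] :
    (0 : Option V → ℝ) ∈ H.suspension.symEdgePolytope := by
  obtain ⟨u⟩ := ‹Nonempty V›
  have hu : spoke u ∈ H.suspension.symEdgePolytope :=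
    subset_convexHull ℝ _ (H.spoke_mem_edgeVectors u)
  have := (convex_convexHull ℝ _) hu (H.suspension.neg_mem_symEdgePolytope hu)
    (a := 1 / 2) (b := 1 / 2) (by norm_num) (by norm_num) (by norm_num)
  rwa [smul_neg, add_neg_cancel] at this

/-- The functional on `ℝ^(V ∪ {none})` with coefficients `c` on `V` and `0` at `none`. -/
def coeffFunctional {V : Type*} [Fintype V] (c : V → ℝ) : StrongDual ℝ (Option V → ℝ) :=
  ∑ u, c u • ContinuousLinearMap.proj (some u)

theorem coeffFunctional_apply {V : Type*} [Fintype V] (c : V → ℝ) (x : Option V → ℝ) :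
    coeffFunctional c x = ∑ u, c u * x (some u) := by
  simp [coeffFunctional]

variable [Fintype V]

theorem coeffFunctional_single_some (c : V → ℝ) (u : V) :
    coeffFunctional c (Pi.single (some u) 1) = c u := by
  rw [coeffFunctional_apply, Finset.sum_eq_single u]
  · simp
  · intro b _ hb
    simp [hb]
  · simp

theorem coeffFunctional_single_none (c : V → ℝ) :
    coeffFunctional c (Pi.single none 1) = 0 := by
  simp [coeffFunctional_apply]

theorem coeffFunctional_spoke (c : V → ℝ) (u : V) : coeffFunctional c (spoke u) = c u := by
  rw [spoke, map_sub, coeffFunctional_single_some, coeffFunctional_single_none, sub_zero]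

/-- The face of the symmetric edge polytope of the suspension cut out by coefficients `c`. -/
def coeffFace (c : V → ℝ) : Set (Option V → ℝ) :=
  {x ∈ H.suspension.symEdgePolytope | coeffFunctional c x = 1}

variable {H}

/-! ### From sign vectors to facets. -/

theorem coeffFunctional_le_one_of_mem_facetSigns {f : V → SignType} (hf : f ∈ H.facetSigns)
    {x : Option V → ℝ} (hx : x ∈ H.suspension.symEdgePolytope) :
    coeffFunctional (fun u => (f u : ℝ)) x ≤ 1 := by
  refine convexHull_min (t := {x | coeffFunctional (fun u => (f u : ℝ)) x ≤ 1}) ?_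
    (convex_halfSpace_le (coeffFunctional (fun u => (f u : ℝ))).isLinear 1) hx
  rintro _ ⟨_ | a, _ | b, hab, rfl⟩
  · exact hab.elim
  · rw [Set.mem_ofPred_eq, map_sub, coeffFunctional_single_some, coeffFunctional_single_none]
    cases f b <;> norm_num
  · rw [Set.mem_ofPred_eq, map_sub, coeffFunctional_single_some, coeffFunctional_single_none]
    cases f a <;> norm_num
  · rw [Set.mem_ofPred_eq, map_sub, coeffFunctional_single_some, coeffFunctional_single_some]
    have := hf.1 a b hab
    revert this
    cases f a <;> cases f b <;> norm_num

/-- At a nonzero vertex the spoke is tight up to sign. At a zero, the edge to a nonzero neighbour is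
tight up to sign and differs from that neighbour's spoke by the wanted one. -/
theorem spoke_mem_span_coeffFace {f : V → SignType} (hf : f ∈ H.facetSigns) (u : V) :
    spoke u ∈ Submodule.span ℝ (H.coeffFace fun u => (f u : ℝ)) := by
  have hne : ∀ w, f w ≠ 0 →
      spoke w ∈ Submodule.span ℝ (H.coeffFace fun u => (f u : ℝ)) := by
    intro w hw
    rcases h : f w
    · exact (hw h).elim
    · rw [← Submodule.neg_mem_iff]
      refine Submodule.subset_span ⟨subset_convexHull ℝ _ (neg_mem_edgeVectors _
        (H.spoke_mem_edgeVectors w)), ?_⟩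
      rw [map_neg, coeffFunctional_spoke, h]
      norm_num
    · refine Submodule.subset_span ⟨subset_convexHull ℝ _ (H.spoke_mem_edgeVectors w), ?_⟩
      rw [coeffFunctional_spoke, h]
      norm_num
  by_cases hu : f u = 0
  · obtain ⟨w, hw, hw0⟩ := hf.2 u hu
    have hmem : (Pi.single (some w) 1 - Pi.single (some u) 1 : Option V → ℝ) ∈
        Submodule.span ℝ (H.coeffFace fun u => (f u : ℝ)) := by
      rcases h : f w
      · exact (hw0 h).elim
      · rw [← Submodule.neg_mem_iff]
        refine Submodule.subset_span ⟨subset_convexHull ℝ _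
          ⟨some u, some w, hw, by simp⟩, ?_⟩
        rw [map_neg, map_sub, coeffFunctional_single_some, coeffFunctional_single_some, h, hu]
        norm_num
      · refine Submodule.subset_span ⟨subset_convexHull ℝ _
          ⟨some w, some u, hw.symm, by simp⟩, ?_⟩
        rw [map_sub, coeffFunctional_single_some, coeffFunctional_single_some, h, hu]
        norm_num
    have := Submodule.sub_mem _ (hne w hw0) hmem
    rwa [spoke, sub_sub_sub_cancel_left] at this
  · exact hne u hu

theorem span_coeffFace_eq {f : V → SignType} (hf : f ∈ H.facetSigns) :
    Submodule.span ℝ (H.coeffFace fun u => (f u : ℝ)) =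
      Submodule.span ℝ H.suspension.edgeVectors := by
  apply le_antisymm
  · rw [Submodule.span_le]
    exact fun x hx => H.suspension.symEdgePolytope_subset_span hx.1
  · rw [span_edgeVectors_suspension, Submodule.span_le]
    rintro _ ⟨u, rfl⟩
    exact spoke_mem_span_coeffFace hf u

theorem coeffFace_nonempty [Nonempty V] {f : V → SignType} (hf : f ∈ H.facetSigns) :
    (H.coeffFace fun u => (f u : ℝ)).Nonempty := by
  by_contra h
  rw [Set.not_nonempty_iff_eq_empty] at h
  obtain ⟨u⟩ := ‹Nonempty V›
  have := spoke_mem_span_coeffFace hf u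
  rw [h, Submodule.span_empty, Submodule.mem_bot] at this
  simpa [spoke] using congrFun this (some u)

theorem isFacet_coeffFace [Nonempty V] {f : V → SignType} (hf : f ∈ H.facetSigns) :
    IsFacet H.suspension.symEdgePolytope (H.coeffFace fun u => (f u : ℝ)) := by
  have hne := coeffFace_nonempty hf
  refine ⟨fun _ => ⟨coeffFunctional fun u => (f u : ℝ), ?_⟩, hne, ?_⟩
  · ext x
    refine ⟨fun hx => ⟨hx.1, fun y hy => ?_⟩, fun hx => ⟨hx.1, ?_⟩⟩
    · rw [hx.2]
      exact coeffFunctional_le_one_of_mem_facetSigns hf hy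
    · obtain ⟨p, hp, hp1⟩ := hne
      exact le_antisymm (coeffFunctional_le_one_of_mem_facetSigns hf hx.1) (hp1 ▸ hx.2 p hp)
  · rw [finrank_vectorSpan_add_one_of_eq_one hne
      (coeffFunctional fun u => (f u : ℝ)).toLinearMap fun x hx => hx.2, span_coeffFace_eq hf]
    exact congrArg (fun S : Submodule ℝ (Option V → ℝ) => finrank ℝ S)
      (vectorSpan_convexHull_eq_span H.zero_mem_symEdgePolytope_suspension).symm

theorem injOn_coeffFace :
    Set.InjOn (fun f : V → SignType => H.coeffFace fun u => (f u : ℝ)) H.facetSigns := by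
  intro f hf g hg hfg
  have hfun : ∀ x ∈ Submodule.span ℝ (H.coeffFace fun u => (f u : ℝ)),
      (coeffFunctional fun u => (f u : ℝ)) x = (coeffFunctional fun u => (g u : ℝ)) x := by
    intro x hx
    refine LinearMap.eqOn_span (f := (coeffFunctional fun u => (f u : ℝ)).toLinearMap)
      (g := (coeffFunctional fun u => (g u : ℝ)).toLinearMap) (fun y hy => ?_) hx
    have hy' : y ∈ H.coeffFace fun u => (g u : ℝ) := hfg.subset hy
    exact hy.2.trans hy'.2.symm
  funext u
  have := hfun _ (spoke_mem_span_coeffFace hf u)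
  rw [coeffFunctional_spoke, coeffFunctional_spoke] at this
  revert this
  cases f u <;> cases g u <;> norm_num

/-- A functional normalised to have maximum `1` whose face is spanning takes values
in `{-1, 0, 1}` on the spokes, and these values form a facet sign vector. -/
theorem exists_facetSigns_of_span_eq (φ : (Option V → ℝ) →ₗ[ℝ] ℝ)
    (hφ : ∀ x ∈ H.suspension.edgeVectors, φ x ≤ 1)
    (hspan : Submodule.span ℝ H.suspension.edgeVectors ≤
      Submodule.span ℝ {x ∈ H.suspension.edgeVectors | φ x = 1}) :
    ∃ f ∈ H.facetSigns, ∀ u, φ (spoke u) = f u := by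
  -- functionals vanishing on the tight edge vectors vanish on the spokes
  have hvan : ∀ c : V → ℝ, (∀ x ∈ H.suspension.edgeVectors, φ x = 1 → coeffFunctional c x = 0) →
      ∀ u, c u = 0 := by
    intro c hc u
    rw [← coeffFunctional_spoke c u]
    have hle : Submodule.span ℝ {x ∈ H.suspension.edgeVectors | φ x = 1} ≤
        LinearMap.ker (coeffFunctional c).toLinearMap := by
      rw [Submodule.span_le]
      exact fun x hx => hc x hx.1 hx.2
    exact hle (hspan (Submodule.subset_span (H.spoke_mem_edgeVectors u)))
  have hdiff : ∀ a b : V, φ (Pi.single (some a) 1 - Pi.single (some b) 1) =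
      φ (spoke a) - φ (spoke b) := by
    intro a b
    rw [← map_sub, spoke, spoke, sub_sub_sub_cancel_right]
  have hnone : ∀ b : V, φ (Pi.single none 1 - Pi.single (some b) 1) = -φ (spoke b) := by
    intro b
    rw [← map_neg, spoke, neg_sub]
  have hint : ∀ u, ∃ k : ℤ, φ (spoke u) = k := by
    classical
    intro u
    -- Tight edges join vertices whose values differ by 1, with value 0 at the apex, so the
    -- indicator of non-integrality vanishes on all of them.
    have := hvan (fun u => if ∃ k : ℤ, φ (spoke u) = k then 0 else 1) ?_ u
    · by_contra h
      simp [h] at this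
    rintro _ ⟨_ | a, _ | b, hab, rfl⟩ h
    · exact hab.elim
    · rw [hnone] at h
      rw [map_sub, coeffFunctional_single_some, coeffFunctional_single_none,
        if_pos ⟨-1, by push_cast; linarith⟩, sub_zero]
    · rw [map_sub, coeffFunctional_single_some, coeffFunctional_single_none,
        if_pos ⟨1, by push_cast; exact h⟩, sub_zero]
    · rw [hdiff] at h
      rw [map_sub, coeffFunctional_single_some, coeffFunctional_single_some, sub_eq_zero]
      refine if_congr ⟨?_, ?_⟩ rfl rfl
      · rintro ⟨k, hk⟩
        exact ⟨k - 1, by push_cast; linarith⟩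
      · rintro ⟨k, hk⟩
        exact ⟨k + 1, by push_cast; linarith⟩
  have hsign : ∀ u, ∃ s : SignType, φ (spoke u) = s := by
    intro u
    obtain ⟨k, hk⟩ := hint u
    have h1 := hφ _ (H.spoke_mem_edgeVectors u)
    have h2 := hφ _ (neg_mem_edgeVectors _ (H.spoke_mem_edgeVectors u))
    rw [map_neg] at h2
    rw [hk] at h1 h2
    have h1' : k ≤ 1 := by exact_mod_cast h1
    have h2' : -k ≤ 1 := by exact_mod_cast h2
    have h3 : -1 ≤ k := by linarith
    rw [hk]
    interval_cases k
    · exact ⟨-1, by norm_num⟩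
    · exact ⟨0, by norm_num⟩
    · exact ⟨1, by norm_num⟩
  choose f hf using hsign
  refine ⟨f, ⟨fun a b hab ha hb => ?_, fun a ha => ?_⟩, hf⟩
  · have := hφ _ ⟨some a, some b, hab, rfl⟩
    rw [hdiff, hf, hf, ha, hb] at this
    norm_num at this
  · by_contra! hcon
    -- With value 0 at `a` and at all its neighbours, no tight edge touches `a`.
    have := hvan (Pi.single a 1) ?_ a
    · simp at this
    rintro _ ⟨_ | i, _ | j, hij, rfl⟩ h
    · exact hij.elim
    · rw [hnone, hf] at h
      have : j ≠ a := by
        rintro rfl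
        rw [ha] at h
        norm_num at h
      simp [coeffFunctional_single_some, coeffFunctional_single_none, this]
    · change φ (spoke i) = 1 at h
      rw [hf] at h
      have : i ≠ a := by
        rintro rfl
        rw [ha] at h
        norm_num at h
      simp [coeffFunctional_single_some, coeffFunctional_single_none, this]
    · rw [hdiff, hf, hf] at h
      have hij' : H.Adj i j := hij
      have hi : i ≠ a := by
        rintro rfl
        rw [ha, hcon j hij'] at h
        norm_num at h
      have hj : j ≠ a := by
        rintro rfl
        rw [ha, hcon i hij'.symm] at h
        norm_num at h
      simp [coeffFunctional_single_some, hi, hj]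

theorem exists_facetSigns_of_isFacet [Nonempty V] {F : Set (Option V → ℝ)}
    (hF : IsFacet H.suspension.symEdgePolytope F) :
    ∃ f ∈ H.facetSigns, (H.coeffFace fun u => (f u : ℝ)) = F := by
  obtain ⟨hexp, hne, hdim⟩ := hF
  obtain ⟨l, hl⟩ := hexp hne
  obtain ⟨p, hp⟩ := hne
  have hpl := hp
  rw [hl] at hpl
  have hvec : vectorSpan ℝ H.suspension.symEdgePolytope =
      Submodule.span ℝ H.suspension.edgeVectors :=
    vectorSpan_convexHull_eq_span H.zero_mem_symEdgePolytope_suspension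
  have hpos : 0 < l p := by
    have h0 : 0 ≤ l p := by simpa using hpl.2 0 H.zero_mem_symEdgePolytope_suspension
    -- A zero maximum on a centrally symmetric polytope makes the face the whole polytope,
    -- contradicting its dimension.
    refine lt_of_le_of_ne h0 fun h => ?_
    have hFP : F = H.suspension.symEdgePolytope := by
      rw [hl]
      refine Set.Subset.antisymm (fun x hx => hx.1) fun x hx => ⟨hx, fun y hy => ?_⟩
      have h1 := hpl.2 y hy
      have h2 := hpl.2 _ (neg_mem_symEdgePolytope _ hx)
      rw [map_neg] at h2
      linarith
    rw [hFP] at hdim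
    omega
  set φ : (Option V → ℝ) →ₗ[ℝ] ℝ := (l p)⁻¹ • l.toLinearMap
  have hφ : ∀ x, φ x = (l p)⁻¹ * l x := fun x => rfl
  have hle : ∀ x ∈ H.suspension.symEdgePolytope, φ x ≤ 1 := by
    intro x hx
    rw [hφ, inv_mul_le_iff₀ hpos, mul_one]
    exact hpl.2 x hx
  have hFeq : F = {x ∈ H.suspension.symEdgePolytope | φ x = 1} := by
    rw [hl]
    ext x
    refine and_congr_right fun hx => ?_
    rw [hφ, inv_mul_eq_one₀ hpos.ne']
    refine ⟨fun h => le_antisymm (h p hpl.1) (hpl.2 x hx), fun h y hy => ?_⟩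
    rw [← h]
    exact hpl.2 y hy
  have hF1 : ∀ x ∈ F, φ x = 1 := by
    intro x hx
    rw [hFeq] at hx
    exact hx.2
  have hFspan : Submodule.span ℝ F = Submodule.span ℝ H.suspension.edgeVectors := by
    refine Submodule.eq_of_le_of_finrank_eq ?_ ?_
    · rw [Submodule.span_le, hFeq]
      exact fun x hx => H.suspension.symEdgePolytope_subset_span hx.1
    · rw [← finrank_vectorSpan_add_one_of_eq_one ⟨p, hp⟩ φ hF1, hdim, hvec]
  have hleE : ∀ x ∈ H.suspension.edgeVectors, φ x ≤ 1 := fun x hx =>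
    hle x (subset_convexHull ℝ _ hx)
  obtain ⟨f, hf, hfφ⟩ := exists_facetSigns_of_span_eq (H := H) φ hleE (by
    rw [← hFspan, Submodule.span_le]
    intro x hx
    refine mem_span_of_mem_convexHull_of_eq_one φ hleE ?_ (hF1 x hx)
    rw [hFeq] at hx
    exact hx.1)
  refine ⟨f, hf, ?_⟩
  rw [hFeq]
  ext x
  refine and_congr_right fun hx => ?_
  have : φ x = (coeffFunctional fun u => (f u : ℝ)).toLinearMap x :=
    H.eqOn_span_edgeVectors_suspension (fun u => (hfφ u).trans
      (coeffFunctional_spoke (fun u => (f u : ℝ)) u).symm)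
      (H.suspension.symEdgePolytope_subset_span hx)
  rw [this]
  rfl

end Facets

/-- Without vertices the polytope is empty and has no facets, yet the empty sign vector would count
once; hence `Nonempty V`. -/
theorem numFacets_symEdgePolytope_suspension {V : Type*} [DecidableEq V] [Finite V] [Nonempty V]
    (H : SimpleGraph V) :
    numFacets H.suspension.symEdgePolytope = H.facetSigns.ncard := by
  have := Fintype.ofFinite V
  have himage : {F | IsFacet H.suspension.symEdgePolytope F} =
      (fun f : V → SignType => H.coeffFace fun u => (f u : ℝ)) '' H.facetSigns := by
    ext F
    refine ⟨fun hF => exists_facetSigns_of_isFacet hF, ?_⟩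
    rintro ⟨f, hf, rfl⟩
    exact isFacet_coeffFace hf
  rw [numFacets, himage, injOn_coeffFace.ncard_image]

end SimpleGraph

/-! ### Facet sign vectors and vertex deletion -/

namespace SimpleGraph

section Counting

variable {V : Type*} (G : SimpleGraph V) (v : V)

/-- The conditions on a sign vector on `V \ {v}` for being a facet sign vector of `G - v`, except
those at the zeros in `N_G(v)`. -/
def IsNearFacetSign (g : ({v}ᶜ : Set V) → SignType) : Prop :=
  (∀ a b : ({v}ᶜ : Set V), G.Adj a b → g a = 1 → g b ≠ -1) ∧
    ∀ a : ({v}ᶜ : Set V), ¬ G.Adj v a → g a = 0 → ∃ b : ({v}ᶜ : Set V), G.Adj a b ∧ g b ≠ 0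

/-- Every zero of `g` in `N_G(v)` has a neighbour in `G - v` at which `g` is nonzero. -/
def NbhdDominated (g : ({v}ᶜ : Set V) → SignType) : Prop :=
  ∀ a : ({v}ᶜ : Set V), G.Adj v a → g a = 0 → ∃ b : ({v}ᶜ : Set V), G.Adj a b ∧ g b ≠ 0

/-- The sign vector `g` takes the value `s` on `N_G(v)`. -/
def NbhdAttains (g : ({v}ᶜ : Set V) → SignType) (s : SignType) : Prop :=
  ∃ a : ({v}ᶜ : Set V), G.Adj v a ∧ g a = s

/-- The sign vectors on `V \ {v}` vanishing on `N_G(v)` that account for the failure of additivity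
of the number of facets. -/
def defectSigns : Set (({v}ᶜ : Set V) → SignType) :=
  {g | G.IsNearFacetSign v g ∧ ¬ G.NbhdAttains v g 1 ∧ ¬ G.NbhdAttains v g (-1) ∧
    ¬ G.NbhdDominated v g}

variable {G v}

theorem forall_iff_and_forall_compl {P : V → Prop} :
    (∀ a, P a) ↔ P v ∧ ∀ a : ({v}ᶜ : Set V), P a := by
  refine ⟨fun h => ⟨h v, fun a => h a⟩, fun h a => ?_⟩
  by_cases ha : a = v
  · exact ha ▸ h.1
  · exact h.2 ⟨a, ha⟩

theorem exists_iff_or_exists_compl {P : V → Prop} :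
    (∃ a, P a) ↔ P v ∨ ∃ a : ({v}ᶜ : Set V), P a := by
  have := forall_iff_and_forall_compl (v := v) (P := fun a => ¬ P a)
  rw [← not_iff_not]
  push Not
  exact this

theorem signType_ne_zero_iff {s : SignType} : s ≠ 0 ↔ s = 1 ∨ s = -1 := by
  decide +revert

theorem exists_nbhd_ne_zero_iff {g : ({v}ᶜ : Set V) → SignType} :
    (∃ b : ({v}ᶜ : Set V), G.Adj v b ∧ g b ≠ 0) ↔
      G.NbhdAttains v g 1 ∨ G.NbhdAttains v g (-1) := by
  simp only [NbhdAttains, signType_ne_zero_iff, and_or_left, exists_or]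

theorem mem_facetSigns_deleteVertex {g : ({v}ᶜ : Set V) → SignType} :
    g ∈ (G.deleteVertex v).facetSigns ↔ G.IsNearFacetSign v g ∧ G.NbhdDominated v g := by
  constructor
  · exact fun h => ⟨⟨h.1, fun a _ => h.2 a⟩, fun a _ => h.2 a⟩
  · rintro ⟨⟨h1, h2⟩, h3⟩
    refine ⟨h1, fun a ha => ?_⟩
    by_cases hva : G.Adj v a
    · exact h3 a hva ha
    · exact h2 a hva ha

/-- The neighbours of `v` form a clique in `G / v`: they cannot carry both signs, and one nonzero
value among them serves all their zeros. -/
theorem mem_facetSigns_contractVertex {g : ({v}ᶜ : Set V) → SignType} :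
    g ∈ (G.contractVertex v).facetSigns ↔ G.IsNearFacetSign v g ∧
      ¬ (G.NbhdAttains v g 1 ∧ G.NbhdAttains v g (-1)) ∧
      (G.NbhdDominated v g ∨ G.NbhdAttains v g 1 ∨ G.NbhdAttains v g (-1)) := by
  rw [← exists_nbhd_ne_zero_iff]
  constructor
  · rintro ⟨h1, h2⟩
    refine ⟨⟨fun a b hab => h1 a b (Or.inl hab), fun a hva ha => ?_⟩, ?_, ?_⟩
    · obtain ⟨b, hab | ⟨-, hva', -⟩, hb⟩ := h2 a ha
      · exact ⟨b, hab, hb⟩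
      · exact (hva hva').elim
    · rintro ⟨⟨a, hva, ha⟩, b, hvb, hb⟩
      refine h1 a b (Or.inr ⟨?_, hva, hvb⟩) ha hb
      rintro rfl
      rw [ha] at hb
      exact absurd hb (by decide)
    · by_cases hex : ∃ b : ({v}ᶜ : Set V), G.Adj v b ∧ g b ≠ 0
      · exact Or.inr hex
      · refine Or.inl fun a hva ha => ?_
        obtain ⟨b, hab | ⟨-, -, hvb⟩, hb⟩ := h2 a ha
        · exact ⟨b, hab, hb⟩
        · exact (hex ⟨b, hvb, hb⟩).elim
  · rintro ⟨⟨h1, h2⟩, h3, h4⟩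
    refine ⟨?_, fun a ha => ?_⟩
    · rintro a b (hab | ⟨-, hva, hvb⟩) ha hb
      · exact h1 a b hab ha hb
      · exact h3 ⟨⟨a, hva, ha⟩, b, hvb, hb⟩
    · by_cases hva : G.Adj v a
      · rcases h4 with h4 | ⟨b, hvb, hb⟩
        · obtain ⟨b, hab, hb⟩ := h4 a hva ha
          exact ⟨b, Or.inl hab, hb⟩
        · refine ⟨b, Or.inr ⟨?_, hva, hvb⟩, hb⟩
          rintro rfl
          exact hb ha
      · obtain ⟨b, hab, hb⟩ := h2 a hva ha
        exact ⟨b, Or.inl hab, hb⟩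

theorem mem_facetSigns_of_apply_eq_zero {f : V → SignType} (hf : f v = 0) :
    f ∈ G.facetSigns ↔ G.IsNearFacetSign v (fun a => f a) ∧ G.NbhdDominated v (fun a => f a) ∧
      (G.NbhdAttains v (fun a => f a) 1 ∨ G.NbhdAttains v (fun a => f a) (-1)) := by
  rw [← exists_nbhd_ne_zero_iff, ← and_assoc, ← mem_facetSigns_deleteVertex]
  simp only [facetSigns, Set.mem_ofPred_eq]
  rw [forall_iff_and_forall_compl (v := v) (P := fun a => ∀ b, _),
    forall_iff_and_forall_compl (v := v) (P := fun a => f a = 0 → _)]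
  have hex : ∀ a, (∃ b, G.Adj a b ∧ f b ≠ 0) ↔ ∃ b : ({v}ᶜ : Set V), G.Adj a b ∧ f b ≠ 0 := by
    intro a
    rw [exists_iff_or_exists_compl (v := v)]
    simp [hf]
  have hall : ∀ a, (∀ b, G.Adj a b → f a = 1 → f b ≠ -1) ↔
      ∀ b : ({v}ᶜ : Set V), G.Adj a b → f a = 1 → f b ≠ -1 := by
    intro a
    rw [forall_iff_and_forall_compl (v := v)]
    simp [hf]
  simp only [hex, hall, hf, forall_const]
  have : ∀ b, G.Adj v b → (0 : SignType) = 1 → f b ≠ -1 := by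
    intro b _ h
    exact absurd h (by decide)
  constructor
  · rintro ⟨⟨-, h1⟩, h2, h3⟩
    exact ⟨⟨h1, h3⟩, h2⟩
  · rintro ⟨⟨h1, h3⟩, h2⟩
    exact ⟨⟨this, h1⟩, h2, h3⟩

/-- A nonzero `v` serves every zero next to it, so `NbhdDominated` drops out and only the opposite
sign is excluded nearby. -/
theorem mem_facetSigns_of_apply_ne_zero {f : V → SignType} (hf : f v ≠ 0) :
    f ∈ G.facetSigns ↔ G.IsNearFacetSign v (fun a => f a) ∧
      ¬ G.NbhdAttains v (fun a => f a) (-f v) := by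
  constructor
  · rintro ⟨h1, h2⟩
    refine ⟨⟨fun a b => h1 a b, fun a hva ha => ?_⟩, ?_⟩
    · obtain ⟨b, hab, hb⟩ := h2 a ha
      have hbv : b ≠ v := by
        rintro rfl
        exact hva hab.symm
      exact ⟨⟨b, hbv⟩, hab, hb⟩
    · rintro ⟨a, hva, ha⟩
      replace ha : f a = -f v := ha
      rcases signType_ne_zero_iff.1 hf with h | h
      · exact h1 v a hva h (by rw [ha, h])
      · exact h1 a v hva.symm (by rw [ha, h]; rfl) h
  · rintro ⟨⟨h1, h2⟩, h3⟩
    refine ⟨fun a b hab ha hb => ?_, fun a ha => ?_⟩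
    · by_cases hav : a = v
      · subst hav
        exact h3 ⟨⟨b, hab.ne'⟩, hab, by simp [ha, hb]⟩
      · by_cases hbv : b = v
        · subst hbv
          exact h3 ⟨⟨a, hav⟩, hab.symm, by simp [ha, hb]⟩
        · exact h1 ⟨a, hav⟩ ⟨b, hbv⟩ hab ha hb
    · have hav : a ≠ v := by
        rintro rfl
        exact hf ha
      by_cases hva : G.Adj v a
      · exact ⟨v, hva.symm, hf⟩
      · obtain ⟨b, hab, hb⟩ := h2 ⟨a, hav⟩ hva ha
        exact ⟨b, hab, hb⟩

open Classical in
theorem ncard_eq_sum_ite {α : Type*} [Fintype α] (s : Set α) :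
    s.ncard = ∑ a, if a ∈ s then 1 else 0 := by
  rw [Set.ncard_eq_toFinset_card', ← Finset.card_filter]
  congr 1
  ext a
  simp

variable (G v)

theorem ncard_facetSigns_eq [Finite V] :
    G.facetSigns.ncard = (G.deleteVertex v).facetSigns.ncard +
      (G.contractVertex v).facetSigns.ncard + 2 * (G.defectSigns v).ncard := by
  classical
  have := Fintype.ofFinite V
  have hsplit : G.facetSigns.ncard = ∑ g : ({v}ᶜ : Set V) → SignType, ∑ s : SignType,
      if (Equiv.funSplitAt v SignType).symm (s, g) ∈ G.facetSigns then 1 else 0 := by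
    rw [ncard_eq_sum_ite, ← (Equiv.funSplitAt v SignType).symm.sum_comp, Fintype.sum_prod_type,
      Finset.sum_comm]
    rfl
  rw [hsplit, ncard_eq_sum_ite, ncard_eq_sum_ite, ncard_eq_sum_ite, Finset.mul_sum,
    ← Finset.sum_add_distrib, ← Finset.sum_add_distrib]
  refine Finset.sum_congr rfl fun g _ => ?_
  have hv : ∀ s : SignType, (Equiv.funSplitAt v SignType).symm (s, g) v = s := by
    intro s
    simp
  have hg : ∀ s : SignType,
      (fun a : ({v}ᶜ : Set V) => (Equiv.funSplitAt v SignType).symm (s, g) a) = g := by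
    intro s
    funext a
    have : (a : V) ≠ v := a.2
    simp [this]
    rfl
  have h0 := mem_facetSigns_of_apply_eq_zero (G := G) (hv 0)
  have h1 := mem_facetSigns_of_apply_ne_zero (G := G) (v := v)
    (f := (Equiv.funSplitAt v SignType).symm (1, g)) (by rw [hv]; decide)
  have h2 := mem_facetSigns_of_apply_ne_zero (G := G) (v := v)
    (f := (Equiv.funSplitAt v SignType).symm (-1, g)) (by rw [hv]; decide)
  rw [hg] at h0 h1 h2
  rw [hv] at h1 h2
  rw [neg_neg] at h2
  rw [SignType.univ_eq, Finset.sum_insert (by decide), Finset.sum_pair (by decide)]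
  simp only [h0, h1, h2, mem_facetSigns_deleteVertex, mem_facetSigns_contractVertex, defectSigns,
    Set.mem_ofPred_eq]
  -- For fixed `g` both sides depend only on these four truth values; the defect term is nonzero
  -- only when the first alone holds.
  by_cases hB : G.IsNearFacetSign v g <;> by_cases hD : G.NbhdDominated v g <;>
    by_cases hP : G.NbhdAttains v g 1 <;> by_cases hN : G.NbhdAttains v g (-1) <;>
    simp [hB, hD, hP, hN]

variable {G v}

theorem eq_zero_of_mem_defectSigns {g : ({v}ᶜ : Set V) → SignType} (hg : g ∈ G.defectSigns v)
    {a : ({v}ᶜ : Set V)} (ha : G.Adj v a) : g a = 0 := by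
  by_contra h
  rcases exists_nbhd_ne_zero_iff.1 ⟨a, ha, h⟩ with h | h
  · exact hg.2.1 h
  · exact hg.2.2.1 h

theorem mem_compl_closedNbhd {a : V} : a ∈ (G.closedNbhd v)ᶜ ↔ ¬ G.Adj v a ∧ a ≠ v := by
  simp [closedNbhd, not_or, and_comm]

variable (G v)

/-- A defect vanishes on the neighbours of `v`, so restriction away from them loses nothing, and the
nonzero neighbour required by an outer zero is itself outside. -/
theorem ncard_defectSigns_le [Finite V] :
    (G.defectSigns v).ncard ≤ (G.deleteClosedNbhd v).facetSigns.ncard := by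
  refine Set.ncard_le_ncard_of_injOn
    (fun g a => g ⟨a, (mem_compl_closedNbhd.1 a.2).2⟩) ?_ ?_ (Set.toFinite _)
  · intro g hg
    refine ⟨fun a b hab => hg.1.1 _ _ hab, fun a ha => ?_⟩
    obtain ⟨b, hab, hb⟩ := hg.1.2 _ (mem_compl_closedNbhd.1 a.2).1 ha
    have hvb : ¬ G.Adj v b := fun h => hb (eq_zero_of_mem_defectSigns hg h)
    exact ⟨⟨b, mem_compl_closedNbhd.2 ⟨hvb, b.2⟩⟩, hab, hb⟩
  · intro g hg g' hg' h
    funext a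
    by_cases ha : G.Adj v a
    · rw [eq_zero_of_mem_defectSigns hg ha, eq_zero_of_mem_defectSigns hg' ha]
    · exact congrFun h ⟨a, mem_compl_closedNbhd.2 ⟨ha, a.2⟩⟩

theorem ncard_defectSigns_of_closedNbhd_eq_univ [Nonempty ({v}ᶜ : Set V)]
    (h : G.closedNbhd v = Set.univ) : (G.defectSigns v).ncard = 1 := by
  have hadj : ∀ a : ({v}ᶜ : Set V), G.Adj v a := by
    intro a
    by_contra ha
    have := mem_compl_closedNbhd.2 ⟨ha, a.2⟩
    simp [h] at this
  rw [Set.ncard_eq_one]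
  refine ⟨0, Set.Subset.antisymm (fun g hg => ?_) ?_⟩
  · exact funext fun a => eq_zero_of_mem_defectSigns hg (hadj a)
  · rintro _ rfl
    refine ⟨⟨fun a b _ ha => absurd ha (by simp), fun a ha => (ha (hadj a)).elim⟩, ?_, ?_, ?_⟩
    · rintro ⟨a, -, ha⟩
      exact absurd ha (by simp)
    · rintro ⟨a, -, ha⟩
      exact absurd ha (by simp)
    -- Zero is undominated because `v` has a neighbour.
    · intro hd
      obtain ⟨a⟩ := ‹Nonempty ({v}ᶜ : Set V)›
      obtain ⟨b, -, hb⟩ := hd a (hadj a) rfl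
      exact hb rfl

end Counting

end SimpleGraph

theorem proposition3p6 {V : Type*} [Fintype V] [DecidableEq V]
    (hV : 2 ≤ Fintype.card V) (G : SimpleGraph V) (v : V) :
    (G.closedNbhd v ≠ Set.univ →
      numFacets (G.deleteVertex v).suspension.symEdgePolytope
          + numFacets (G.contractVertex v).suspension.symEdgePolytope
        ≤ numFacets G.suspension.symEdgePolytope ∧
      numFacets G.suspension.symEdgePolytope
        ≤ numFacets (G.deleteVertex v).suspension.symEdgePolytope
          + 2 * numFacets (G.deleteClosedNbhd v).suspension.symEdgePolytope
          + numFacets (G.contractVertex v).suspension.symEdgePolytope) ∧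
    (G.closedNbhd v = Set.univ →
      numFacets G.suspension.symEdgePolytope
        = numFacets (G.deleteVertex v).suspension.symEdgePolytope
          + numFacets (G.contractVertex v).suspension.symEdgePolytope + 2) := by
  have : Nontrivial V := Fintype.one_lt_card_iff_nontrivial.1 hV
  have : Nonempty ({v}ᶜ : Set V) := by
    obtain ⟨w, hw⟩ := exists_ne v
    exact ⟨⟨w, hw⟩⟩
  have hcount := G.ncard_facetSigns_eq v
  rw [numFacets_symEdgePolytope_suspension, numFacets_symEdgePolytope_suspension,
    numFacets_symEdgePolytope_suspension]
  refine ⟨fun h => ?_, fun h => ?_⟩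
  · have : Nonempty ((G.closedNbhd v)ᶜ : Set V) :=
      (Set.nonempty_compl.2 h).to_subtype
    rw [numFacets_symEdgePolytope_suspension]
    have := G.ncard_defectSigns_le v
    omega
  · rw [G.ncard_defectSigns_of_closedNbhd_eq_univ v h] at hcount
    omega
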